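/- For a real random variable $Y$ let $\|Y\|_{\psi_2}=\inf\{u>0:\ \mathbb{E}\exp(Y^2/u^2)\le 2\}$. A probability measure $\mu$ on $\mathbb{R}^n$ is called isotropic if $\mathbb{E}\langle X,y\rangle^2=|y|^2$ for every $y\in\mathbb{R}^n$, and is said to satisfy a $\psi_2$ condition with constant $\alpha$ if $\|\langle X,y\rangle\|_{\psi_2}\le\alpha|y|$ for every $y\in\mathbb{R}^n$, where $X$ is distributed according to $\mu$ and $|\cdot|$ is the Euclidean norm. There exist absolute constants $c>1$, $C>0$ and $\bar c>0$ for which the following holds. Let $1\le k\le n$ be integers, let $\alpha\ge 1$, and let $\mu$ be an isotropic probability measure on $\mathbb{R}^n$ satisfying a $\psi_2$ condition with constant $\alpha$. Let $X_1,\dots,X_k$ be independent random vectors distributed according to $\mu$, and let $\Gamma=\sum_{i=1}^k\langle X_i,\cdot\rangle e_i$ be the random $k\times n$ matrix with rows $X_1,\dots,X_k$. Then, with probability at least $1-\exp(-\bar c\,k/\alpha^4)$, every vector $z\in\mathbb{R}^n$ satisfying $$ |\{i: z_i\neq 0\}|\le \frac{C k}{\alpha^4\log(c\,n\,\alpha^4/k)}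 $$ is the unique minimizer of the problem $$ \min \|t\|_{\ell_1}=\min\sum_{i=1}^n|t_i|\quad\text{subject to } t\in\mathbb{R}^n,\ \Gamma t=\Gamma z . $$ -/

import Mathlib

open MeasureTheory ProbabilityTheory
open scoped ENNReal

noncomputable section

/-- The `ψ₂` norm `inf {u > 0 : 𝔼 exp (Y² / u²) ≤ 2}` of a real random variable `Y`, with values in
`[0, ∞]`; it is `∞` if no such `u` exists. -/
def psi2Norm {Ω : Type*} [MeasurableSpace Ω] (P : Measure Ω) (Y : Ω → ℝ) : ℝ≥0∞ :=
  ⨅ (u : ℝ) (_ : 0 < u) (_ : ∫⁻ ω, ENNReal.ofReal (Real.exp (Y ω ^ 2 / u ^ 2)) ∂P ≤ 2),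
    ENNReal.ofReal u

/-- `μ` is isotropic: `𝔼 ⟨X, y⟩² = |y|²` for every `y`, where `X` is distributed according to `μ`. -/
def IsIsotropic {n : ℕ} (μ : Measure (EuclideanSpace ℝ (Fin n))) : Prop :=
  ∀ y : EuclideanSpace ℝ (Fin n),
    ∫⁻ x, ENNReal.ofReal (inner ℝ x y ^ 2) ∂μ = ENNReal.ofReal (‖y‖ ^ 2)

/-- `μ` satisfies a `ψ₂` condition with constant `α`: `‖⟨X, y⟩‖_{ψ₂} ≤ α |y|` for every `y`. -/
def IsPsi2With {n : ℕ} (μ : Measure (EuclideanSpace ℝ (Fin n))) (α : ℝ) : Prop :=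
  ∀ y : EuclideanSpace ℝ (Fin n),
    psi2Norm μ (fun x => inner ℝ x y) ≤ ENNReal.ofReal (α * ‖y‖)

/-- The operator `Γ = ∑ᵢ ⟨xᵢ, ·⟩ eᵢ` from `ℝⁿ` to `ℝᵏ`, i.e. the `k × n` matrix with rows `xᵢ`. -/
def rowOperator {k n : ℕ} (x : Fin k → EuclideanSpace ℝ (Fin n)) :
    EuclideanSpace ℝ (Fin n) →L[ℝ] EuclideanSpace ℝ (Fin k) :=
  ∑ i, (innerSL ℝ (x i)).smulRight (EuclideanSpace.single i (1 : ℝ))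

/-- The `ℓ₁` norm on `ℝⁿ`. -/
def l1Norm {n : ℕ} (t : EuclideanSpace ℝ (Fin n)) : ℝ := ∑ i, |t i|

/-- The cardinality of the support `{i : zᵢ ≠ 0}`. -/
def suppCard {n : ℕ} (z : EuclideanSpace ℝ (Fin n)) : ℕ :=
  (Finset.univ.filter fun i => z i ≠ 0).card

/-- `z` is the unique minimizer of `f` on `s`. -/
def IsUniqueMinimizerOn {E : Type*} (f : E → ℝ) (s : Set E) (z : E) : Prop :=
  z ∈ s ∧ ∀ t ∈ s, t ≠ z → f z < f t

end

/-! With overwhelming probability `‖Γ v‖²` is comparable to `k ‖v‖²` for all `m`-sparse `v`; this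
restricted isomorphism alone forces `ℓ₁` recovery at sparsity `s = m / 1026`.

Probabilistic half: for fixed `y`, Bernstein's method concentrates `‖Γ y‖²` around `k ‖y‖²`
(`measureReal_norm_rowOperator`). A union bound over supports and nets (`measureReal_sparse_bounds`)
costs a factor that the logarithm in the sparsity bound keeps below the probability gain
(`choose_mul_pow_le_exp`).

Deterministic half: if `t` competes with `z`, then `h = t - z` is a kernel vector with most of its
`ℓ₁` mass on the support of `z`, so `‖h‖₁² ≤ 4 s ‖h‖²`. Maurey's method approximates a kernel vector
by sparse ones and gives the opposite inequality (`l1Norm_lower_bound_of_mem_ker`), so `h = 0`. -/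

/-! ### Nets and operators on sparse vectors -/

/-- The unit ball of a finite-dimensional normed space has a `1/2`-net of at most `5 ^ d` points. -/
theorem exists_half_net (E : Type*) [NormedAddCommGroup E] [NormedSpace ℝ E]
    [FiniteDimensional ℝ E] :
    ∃ N : Finset E, N.card ≤ 5 ^ Module.finrank ℝ E ∧
      ∀ x : E, ‖x‖ ≤ 1 → ∃ y ∈ N, ‖x - y‖ ≤ 1 / 2 := by
  classical
  let p : Finset E → Prop := fun s =>
    (∀ c ∈ s, ‖c‖ ≤ 2) ∧ ∀ c ∈ s, ∀ d ∈ s, c ≠ d → 1 ≤ ‖c - d‖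
  let M : Set ℕ := {m | ∃ s, p s ∧ s.card = m}
  have hne : M.Nonempty := ⟨0, ∅, by simp [p], rfl⟩
  have hbdd : BddAbove M := by
    refine ⟨5 ^ Module.finrank ℝ E, ?_⟩
    rintro _ ⟨s, hs, rfl⟩
    exact Besicovitch.card_le_of_separated s hs.1 hs.2
  -- A 1-separated set of maximal cardinality in the ball of radius 2 is a 1-net of that ball;
  -- halving it gives the claim.
  obtain ⟨s, hs, hcard⟩ := Nat.sSup_mem hne hbdd
  refine ⟨s.image (fun c => (1 / 2 : ℝ) • c), Finset.card_image_le.trans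
    (Besicovitch.card_le_of_separated s hs.1 hs.2), fun x hx => ?_⟩
  have hx2 : ‖(2 : ℝ) • x‖ ≤ 2 := by
    rw [norm_smul]; norm_num; linarith
  obtain ⟨c, hc, hlt⟩ : ∃ c ∈ s, ‖(2 : ℝ) • x - c‖ < 1 := by
    by_contra! hcon
    have hnot : (2 : ℝ) • x ∉ s := fun h => by
      have := hcon _ h
      simp at this
      linarith
    have hp : p (insert ((2 : ℝ) • x) s) := by
      refine ⟨?_, ?_⟩
      · intro c hc
        rcases Finset.mem_insert.1 hc with rfl | hc
        · exact hx2
        · exact hs.1 c hc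
      · intro c hc d hd hcd
        rcases Finset.mem_insert.1 hc with rfl | hc <;>
          rcases Finset.mem_insert.1 hd with rfl | hd
        · exact absurd rfl hcd
        · exact hcon d hd
        · rw [norm_sub_rev]; exact hcon c hc
        · exact hs.2 c hc d hd hcd
    have := le_csSup hbdd ⟨_, hp, rfl⟩
    rw [Finset.card_insert_of_notMem hnot, hcard] at this
    omega
  refine ⟨(1 / 2 : ℝ) • c, Finset.mem_image_of_mem _ hc, ?_⟩
  have : x - (1 / 2 : ℝ) • c = (1 / 2 : ℝ) • ((2 : ℝ) • x - c) := by
    rw [smul_sub, smul_smul]; norm_num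
  rw [this, norm_smul]
  norm_num
  linarith

/-- The unit ball of a finite-dimensional normed space has a `1/4`-net of at most `25 ^ d` points. -/
theorem exists_quarter_net (E : Type*) [NormedAddCommGroup E] [NormedSpace ℝ E]
    [FiniteDimensional ℝ E] :
    ∃ N : Finset E, N.card ≤ 25 ^ Module.finrank ℝ E ∧
      ∀ x : E, ‖x‖ ≤ 1 → ∃ y ∈ N, ‖x - y‖ ≤ 1 / 4 := by
  classical
  obtain ⟨N, hN, hnet⟩ := exists_half_net E
  refine ⟨(N ×ˢ N).image (fun p => p.1 + (1 / 2 : ℝ) • p.2), ?_, fun x hx => ?_⟩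
  · refine Finset.card_image_le.trans ?_
    rw [Finset.card_product, show 25 = 5 * 5 by rfl, mul_pow]
    gcongr
  · obtain ⟨y, hy, hxy⟩ := hnet x hx
    -- The doubled residual lies in the unit ball again, so the same net is used twice.
    obtain ⟨y', hy', hxy'⟩ := hnet ((2 : ℝ) • (x - y)) (by
      rw [norm_smul]; norm_num; linarith)
    refine ⟨y + (1 / 2 : ℝ) • y', Finset.mem_image.2 ⟨(y, y'), by simp [hy, hy'], rfl⟩, ?_⟩
    have : x - (y + (1 / 2 : ℝ) • y') = (1 / 2 : ℝ) • ((2 : ℝ) • (x - y) - y') := by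
      rw [smul_sub, smul_smul]; norm_num; abel
    rw [this, norm_smul]
    norm_num
    linarith

/-- An operator that is almost a multiple of an isometry on a `1/4`-net is an isomorphism. -/
theorem norm_bounds_of_quarter_net {E F : Type*} [NormedAddCommGroup E] [NormedSpace ℝ E]
    [NormedAddCommGroup F] [NormedSpace ℝ F] (A : E →L[ℝ] F) {N : Set E}
    (hnet : ∀ x : E, ‖x‖ ≤ 1 → ∃ y ∈ N, ‖x - y‖ ≤ 1 / 4) {κ : ℝ} (hκ : 0 ≤ κ)
    (hlow : ∀ y ∈ N, 3 / 4 * κ * ‖y‖ ^ 2 ≤ ‖A y‖ ^ 2)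
    (hupp : ∀ y ∈ N, ‖A y‖ ^ 2 ≤ 5 / 4 * κ * ‖y‖ ^ 2) (x : E) :
    κ / 64 * ‖x‖ ^ 2 ≤ ‖A x‖ ^ 2 ∧ ‖A x‖ ^ 2 ≤ 4 * κ * ‖x‖ ^ 2 := by
  obtain ⟨r, hr, rfl⟩ : ∃ r : ℝ, 0 ≤ r ∧ r ^ 2 = κ := ⟨√κ, κ.sqrt_nonneg, Real.sq_sqrt hκ⟩
  have hlow' : ∀ y ∈ N, 86 / 100 * r * ‖y‖ ≤ ‖A y‖ := fun y hy => by
    refine (sq_le_sq₀ (by positivity) (norm_nonneg _)).1 ?_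
    nlinarith [hlow y hy, sq_nonneg (r * ‖y‖)]
  have hupp' : ∀ y ∈ N, ‖A y‖ ≤ 112 / 100 * r * ‖y‖ := fun y hy => by
    refine (sq_le_sq₀ (norm_nonneg _) (by positivity)).1 ?_
    nlinarith [hupp y hy, sq_nonneg (r * ‖y‖)]
  -- The operator norm is bounded in terms of itself: `1.12 · 5/4 = 1.4` from the net point, `‖A‖ /
  -- 4` from the error.
  have hA : ‖A‖ ≤ 14 / 10 * r + ‖A‖ / 4 := by
    refine ContinuousLinearMap.opNorm_le_of_unit_norm (by positivity) fun x hx => ?_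
    obtain ⟨y, hy, hxy⟩ := hnet x hx.le
    have h1 : ‖A x‖ ≤ ‖A y‖ + ‖A (x - y)‖ := by
      simpa using norm_add_le (A y) (A (x - y))
    have h2 : ‖A (x - y)‖ ≤ ‖A‖ * (1 / 4) :=
      (A.le_opNorm _).trans (by gcongr)
    have h3 : ‖y‖ ≤ 5 / 4 := by
      have := norm_sub_norm_le y x
      rw [norm_sub_rev] at this
      linarith
    have h4 := hupp' y hy
    nlinarith
  have hA2 : ‖A‖ ≤ 2 * r := by linarith
  -- `0.86 · 3/4 - 2 · 1/4 = 0.145 > 1/8`; in this argument a `1/2`-net would leave nothing.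
  have hunit : ∀ x : E, ‖x‖ = 1 → r / 8 ≤ ‖A x‖ := fun x hx => by
    obtain ⟨y, hy, hxy⟩ := hnet x hx.le
    have h1 : ‖A y‖ ≤ ‖A x‖ + ‖A (x - y)‖ := by
      have := norm_sub_le (A x) (A (x - y))
      simpa using this
    have h2 : ‖A (x - y)‖ ≤ ‖A‖ * (1 / 4) :=
      (A.le_opNorm _).trans (by gcongr)
    have h3 : 3 / 4 ≤ ‖y‖ := by
      have := norm_sub_norm_le x y
      linarith
    have h4 := hlow' y hy
    nlinarith
  have hlower : r / 8 * ‖x‖ ≤ ‖A x‖ := by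
    rcases eq_or_ne x 0 with rfl | hx
    · simp
    · have := hunit ((‖x‖⁻¹ : ℝ) • x) (by
        rw [norm_smul, norm_inv, norm_norm, inv_mul_cancel₀ (norm_ne_zero_iff.2 hx)])
      rw [map_smul, norm_smul, norm_inv, norm_norm, ← div_eq_inv_mul,
        le_div_iff₀ (norm_pos_iff.2 hx)] at this
      exact this
  have hupper : ‖A x‖ ≤ 2 * r * ‖x‖ := (A.le_opNorm x).trans (by gcongr)
  constructor
  · calc r ^ 2 / 64 * ‖x‖ ^ 2 = (r / 8 * ‖x‖) ^ 2 := by ring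
      _ ≤ _ := by gcongr
  · calc ‖A x‖ ^ 2 ≤ (2 * r * ‖x‖) ^ 2 := by gcongr
      _ = _ := by ring

/-- A finite set of at most `25 ^ |T|` test vectors controls an operator on the vectors supported
in `T`. -/
theorem exists_test_vectors {n : ℕ} (T : Finset (Fin n)) :
    ∃ N : Finset (EuclideanSpace ℝ (Fin n)), N.card ≤ 25 ^ T.card ∧
      ∀ {k : ℕ} (A : EuclideanSpace ℝ (Fin n) →L[ℝ] EuclideanSpace ℝ (Fin k)) (κ : ℝ), 0 ≤ κ →
        (∀ y ∈ N, 3 / 4 * κ * ‖y‖ ^ 2 ≤ ‖A y‖ ^ 2 ∧ ‖A y‖ ^ 2 ≤ 5 / 4 * κ * ‖y‖ ^ 2) →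
        ∀ x : EuclideanSpace ℝ (Fin n), (∀ i ∉ T, x i = 0) →
          κ / 64 * ‖x‖ ^ 2 ≤ ‖A x‖ ^ 2 ∧ ‖A x‖ ^ 2 ≤ 4 * κ * ‖x‖ ^ 2 := by
  classical
  let B : Finset (EuclideanSpace ℝ (Fin n)) := T.image fun i => EuclideanSpace.single i (1 : ℝ)
  let V := Submodule.span ℝ (B : Set (EuclideanSpace ℝ (Fin n)))
  obtain ⟨N, hN, hnet⟩ := exists_quarter_net V
  refine ⟨N.image (V.subtypeL), ?_, fun A κ hκ h x hx => ?_⟩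
  · refine Finset.card_image_le.trans (hN.trans ?_)
    exact Nat.pow_le_pow_right (by norm_num)
      ((finrank_span_finset_le_card B).trans Finset.card_image_le)
  · have hxV : x ∈ V := by
      have hsum : x = ∑ i ∈ T, x i • EuclideanSpace.single i (1 : ℝ) := by
        ext j
        by_cases hj : j ∈ T
        · simp [Finset.sum_apply, hj, Pi.single_apply]
        · simp [Finset.sum_apply, hj, hx j hj, Pi.single_apply]
      rw [hsum]
      refine Submodule.sum_mem _ fun i hi => Submodule.smul_mem _ _ (Submodule.subset_span ?_)
      exact Finset.mem_coe.2 (Finset.mem_image_of_mem _ hi)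
    exact norm_bounds_of_quarter_net (A.comp V.subtypeL) (N := N) hnet hκ
      (fun y hy => (h _ (Finset.mem_image_of_mem _ hy)).1)
      (fun y hy => (h _ (Finset.mem_image_of_mem _ hy)).2) ⟨x, hxV⟩

/-! ### Maurey's method and `ℓ₁` recovery -/

/-- The bracket is the variance of `Z` under the weights. It does not depend on `u`, so each step of
the induction below costs the same amount. -/
theorem sum_weight_mul_norm_add_sq {ι H : Type*} [Fintype ι] [NormedAddCommGroup H]
    [InnerProductSpace ℝ H] (w : ι → ℝ) (hw : ∑ j, w j = 1) (Z : ι → H) (u : H) :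
    ∑ j, w j * ‖u + Z j‖ ^ 2 =
      ‖u + ∑ j, w j • Z j‖ ^ 2 + (∑ j, w j * ‖Z j‖ ^ 2 - ‖∑ j, w j • Z j‖ ^ 2) := by
  simp only [norm_add_sq_real, mul_add, Finset.sum_add_distrib, ← Finset.sum_mul, hw, inner_sum,
    inner_smul_right, Finset.mul_sum]
  have : ∀ j, w j * (2 * inner ℝ u (Z j)) = 2 * (w j * inner ℝ u (Z j)) := fun j => by ring
  simp only [this]
  ring

/-- Maurey's empirical method, derandomised, for the quadratic form `‖A v‖² - a ‖v‖²`. -/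
theorem exists_empirical_sum {ι H F : Type*} [Fintype ι] [NormedAddCommGroup H]
    [InnerProductSpace ℝ H] [NormedAddCommGroup F] [InnerProductSpace ℝ F] (A : H →L[ℝ] F) (a : ℝ)
    (w : ι → ℝ) (hw0 : ∀ j, 0 ≤ w j) (hw : ∑ j, w j = 1) (Z : ι → H) (x : H)
    (hx : ∑ j, w j • Z j = x) (m : ℕ) (u : H) :
    ∃ f : Fin m → ι,
      ‖A (u + ∑ i, Z (f i))‖ ^ 2 - a * ‖u + ∑ i, Z (f i)‖ ^ 2 ≤
        ‖A (u + (m : ℝ) • x)‖ ^ 2 - a * ‖u + (m : ℝ) • x‖ ^ 2 +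
          m * (∑ j, w j * (‖A (Z j)‖ ^ 2 - a * ‖Z j‖ ^ 2) - (‖A x‖ ^ 2 - a * ‖x‖ ^ 2)) := by
  induction m generalizing u with
  | zero => exact ⟨Fin.elim0, by simp⟩
  | succ m ih =>
    set D := ∑ j, w j * (‖A (Z j)‖ ^ 2 - a * ‖Z j‖ ^ 2) - (‖A x‖ ^ 2 - a * ‖x‖ ^ 2) with hD
    let Q : H → ℝ := fun v => ‖A v‖ ^ 2 - a * ‖v‖ ^ 2
    have havg : ∑ j, w j * Q (u + (m : ℝ) • x + Z j) = Q (u + ((m + 1 : ℕ) : ℝ) • x) + D := by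
      have h1 := sum_weight_mul_norm_add_sq w hw Z (u + (m : ℝ) • x)
      have h2 := sum_weight_mul_norm_add_sq w hw (fun j => A (Z j)) (A (u + (m : ℝ) • x))
      have hAx : ∑ j, w j • A (Z j) = A x := by rw [← hx]; simp
      have hu : u + ((m + 1 : ℕ) : ℝ) • x = u + (m : ℝ) • x + x := by
        push_cast; rw [add_smul, one_smul, add_assoc]
      rw [hx] at h1
      rw [hAx] at h2
      simp only [← map_add] at h2
      simp only [Q, hD, mul_sub, Finset.sum_sub_distrib, hu]
      have h3 : ∀ v : ι → H, ∑ j, w j * (a * ‖v j‖ ^ 2) = a * ∑ j, w j * ‖v j‖ ^ 2 := fun v => by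
        rw [Finset.mul_sum]; exact Finset.sum_congr rfl fun j _ => by ring
      rw [h3, h3, h1, h2]
      ring
    -- One copy of `x` is exchanged for some `Z j`: a value no larger than the average must occur.
    obtain ⟨j, hj⟩ : ∃ j, Q (u + (m : ℝ) • x + Z j) ≤ Q (u + ((m + 1 : ℕ) : ℝ) • x) + D := by
      by_contra! hcon
      have hle : ∑ j, w j * (Q (u + ((m + 1 : ℕ) : ℝ) • x) + D) <
          ∑ j, w j * Q (u + (m : ℝ) • x + Z j) := by
        obtain ⟨j, -, hj⟩ : ∃ j ∈ Finset.univ, w j ≠ 0 :=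
          Finset.exists_ne_zero_of_sum_ne_zero (by rw [hw]; exact one_ne_zero)
        exact Finset.sum_lt_sum (fun j _ => mul_le_mul_of_nonneg_left (hcon j).le (hw0 j))
          ⟨j, Finset.mem_univ j, mul_lt_mul_of_pos_left (hcon j) ((hw0 j).lt_of_ne' hj)⟩
      rw [← Finset.sum_mul, hw, one_mul, havg] at hle
      exact lt_irrefl _ hle
    obtain ⟨f, hf⟩ := ih (u + Z j)
    refine ⟨Fin.cons j f, ?_⟩
    rw [Fin.sum_univ_succ]
    simp only [Fin.cons_zero, Fin.cons_succ, ← add_assoc]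
    refine hf.trans ?_
    have h1 : u + Z j + (m : ℝ) • x = u + (m : ℝ) • x + Z j := by abel
    rw [h1]
    push_cast at hj ⊢
    simp only [Q] at hj
    linarith

/-- An operator bounded below on sparse vectors has no kernel vector of small `ℓ₁` norm. -/
theorem l1Norm_lower_bound_of_mem_ker {n k : ℕ}
    (A : EuclideanSpace ℝ (Fin n) →L[ℝ] EuclideanSpace ℝ (Fin k)) {a b : ℝ} {m : ℕ} (hm : 1 ≤ m)
    (ha : 0 ≤ a)
    (hlow : ∀ v : EuclideanSpace ℝ (Fin n), suppCard v ≤ m → a * ‖v‖ ^ 2 ≤ ‖A v‖ ^ 2)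
    (hcol : ∀ j, ‖A (EuclideanSpace.single j 1)‖ ^ 2 ≤ b)
    {x : EuclideanSpace ℝ (Fin n)} (hx : A x = 0) :
    ((m : ℝ) - 1) * a * ‖x‖ ^ 2 ≤ b * l1Norm x ^ 2 := by
  classical
  rcases eq_or_ne x 0 with rfl | hx0
  · simp [l1Norm]
  set L := l1Norm x with hL
  have hLpos : 0 < L := by
    obtain ⟨i, hi⟩ : ∃ i, x i ≠ 0 := by
      by_contra! h
      exact hx0 (by ext i; simpa using h i)
    exact Finset.sum_pos' (fun _ _ => abs_nonneg _) ⟨i, Finset.mem_univ i, abs_pos.2 hi⟩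
  -- `x` is a convex combination of the signed vertices `± L e_j` of its `ℓ₁` ball, and a sum of `m`
  -- of them is `m`-sparse.
  let w : Fin n → ℝ := fun j => |x j| / L
  let Z : Fin n → EuclideanSpace ℝ (Fin n) := fun j =>
    (L * (SignType.sign (x j) : ℝ)) • EuclideanSpace.single j (1 : ℝ)
  have hw0 : ∀ j, 0 ≤ w j := fun j => by positivity
  have hw : ∑ j, w j = 1 := by
    simp only [w, ← Finset.sum_div]
    exact div_self hLpos.ne'
  have hsum : ∑ j, w j • Z j = x := by
    ext i
    have : |x i| / L * (L * (SignType.sign (x i) : ℝ)) = x i := by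
      field_simp
      exact abs_mul_sign _
    simp [w, Z, Finset.sum_apply, Pi.single_apply, this]
  obtain ⟨f, hf⟩ := exists_empirical_sum A a w hw0 hw Z x hsum m 0
  simp only [zero_add, map_smul, hx, smul_zero, norm_zero, norm_smul] at hf
  have hsupp : suppCard (∑ i, Z (f i)) ≤ m := by
    have : (Finset.univ.filter fun i => (∑ i, Z (f i)) i ≠ 0) ⊆ Finset.univ.image f := by
      intro i hi
      by_contra hcon
      simp only [Finset.mem_image, Finset.mem_univ, true_and, not_exists] at hcon
      refine (Finset.mem_filter.1 hi).2 ?_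
      simp only [Z, WithLp.ofLp_sum, Finset.sum_apply]
      refine Finset.sum_eq_zero fun l _ => ?_
      simp [Ne.symm (hcon l)]
    exact (Finset.card_le_card this).trans (Finset.card_image_le.trans (by simp))
  have hD : ∑ j, w j * (‖A (Z j)‖ ^ 2 - a * ‖Z j‖ ^ 2) ≤ b * L ^ 2 := by
    have hone : ∑ j, w j * (b * L ^ 2) = b * L ^ 2 := by rw [← Finset.sum_mul, hw, one_mul]
    rw [← hone]
    refine Finset.sum_le_sum fun j _ => mul_le_mul_of_nonneg_left ?_ (hw0 j)
    have h1 : ‖A (Z j)‖ ^ 2 ≤ b * L ^ 2 := by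
      have hs : (SignType.sign (x j) : ℝ) ^ 2 ≤ 1 := by
        rcases lt_trichotomy (x j) 0 with h | h | h <;> simp [h]
      simp only [Z, map_smul, norm_smul, mul_pow, Real.norm_eq_abs, sq_abs]
      have hb := hcol j
      have h0 := sq_nonneg ‖A (EuclideanSpace.single j 1)‖
      calc L ^ 2 * (SignType.sign (x j) : ℝ) ^ 2 * ‖A (EuclideanSpace.single j 1)‖ ^ 2
          ≤ L ^ 2 * 1 * b := by gcongr
        _ = b * L ^ 2 := by ring
    have : 0 ≤ a * ‖Z j‖ ^ 2 := by positivity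
    linarith
  have h0 := hlow _ hsupp
  have hmpos : (0 : ℝ) < m := by exact_mod_cast hm
  -- Since `A x = 0`, the form at `m x` is `-a m² ‖x‖²`; the variance term returns `a m ‖x‖²`,
  -- whence `m - 1`.
  have h1 : 0 ≤ (m : ℝ) * (b * L ^ 2 - ((m : ℝ) - 1) * a * ‖x‖ ^ 2) := by
    have h2 := mul_le_mul_of_nonneg_left hD hmpos.le
    simp only [Real.norm_natCast] at hf
    nlinarith
  have := nonneg_of_mul_nonneg_right h1 hmpos
  linarith

/-- Exact reconstruction by `ℓ₁` minimisation. -/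
theorem isUniqueMinimizerOn_l1Norm {n k : ℕ}
    (A : EuclideanSpace ℝ (Fin n) →L[ℝ] EuclideanSpace ℝ (Fin k)) {a b : ℝ} {m s : ℕ} (hm : 1 ≤ m)
    (ha : 0 ≤ a) (hb : 0 ≤ b) (hab : 4 * b * s < ((m : ℝ) - 1) * a)
    (hlow : ∀ v : EuclideanSpace ℝ (Fin n), suppCard v ≤ m → a * ‖v‖ ^ 2 ≤ ‖A v‖ ^ 2)
    (hcol : ∀ j, ‖A (EuclideanSpace.single j 1)‖ ^ 2 ≤ b)
    {z : EuclideanSpace ℝ (Fin n)} (hz : suppCard z ≤ s) :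
    IsUniqueMinimizerOn l1Norm {t | A t = A z} z := by
  classical
  refine ⟨rfl, fun t ht htz => ?_⟩
  by_contra! hle
  set h := t - z with hh
  have hh0 : h ≠ 0 := sub_ne_zero.2 htz
  have hker : A h = 0 := by rw [hh, map_sub, ht, sub_self]
  set S := Finset.univ.filter fun i => z i ≠ 0 with hS
  have hcone : l1Norm h ≤ 2 * ∑ i ∈ S, |h i| := by
    -- Off the support `t i = h i`, with equality; on it this is the triangle inequality.
    have hpt : ∀ i, |h i| + |z i| ≤ |t i| + 2 * (if i ∈ S then |h i| else 0) := fun i => by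
      have hi : t i = h i + z i := by simp [hh]
      by_cases hiS : i ∈ S
      · rw [if_pos hiS]
        have : |z i| ≤ |t i| + |h i| := by
          have := abs_sub (t i) (h i)
          rwa [hi, add_sub_cancel_left, ← hi] at this
        linarith
      · have : z i = 0 := by simpa [hS] using hiS
        rw [if_neg hiS, hi, this]
        simp
    have hsum := Finset.sum_le_sum fun i (_ : i ∈ Finset.univ) => hpt i
    rw [Finset.sum_add_distrib, Finset.sum_add_distrib, ← Finset.mul_sum, ← Finset.sum_filter,
      Finset.filter_mem_eq_inter, Finset.univ_inter] at hsum
    simp only [l1Norm] at hle ⊢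
    linarith
  have hcs : (∑ i ∈ S, |h i|) ^ 2 ≤ s * ‖h‖ ^ 2 := by
    calc (∑ i ∈ S, |h i|) ^ 2 ≤ S.card * ∑ i ∈ S, |h i| ^ 2 := sq_sum_le_card_mul_sum_sq
      _ ≤ s * ∑ i, |h i| ^ 2 := by
        have h1 : (S.card : ℝ) ≤ s := by exact_mod_cast hz
        have h2 : ∑ i ∈ S, |h i| ^ 2 ≤ ∑ i, |h i| ^ 2 :=
          Finset.sum_le_sum_of_subset_of_nonneg (Finset.subset_univ _) fun _ _ _ => by positivity
        gcongr
      _ = s * ‖h‖ ^ 2 := by rw [EuclideanSpace.norm_sq_eq]; simp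
  have hl0 : 0 ≤ l1Norm h := Finset.sum_nonneg fun _ _ => abs_nonneg _
  have hl1 : l1Norm h ^ 2 ≤ 4 * (s * ‖h‖ ^ 2) := by
    have : l1Norm h ^ 2 ≤ (2 * ∑ i ∈ S, |h i|) ^ 2 := by gcongr
    nlinarith
  have hkey := l1Norm_lower_bound_of_mem_ker A hm ha hlow hcol hker
  have hn : 0 < ‖h‖ ^ 2 := by have := norm_pos_iff.2 hh0; positivity
  have h2 := mul_le_mul_of_nonneg_left hl1 hb
  nlinarith [mul_lt_mul_of_pos_right hab hn]

/-! ### Exponential moments and concentration of `‖Γ y‖²` -/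

theorem norm_rowOperator_sq {k n : ℕ} (x : Fin k → EuclideanSpace ℝ (Fin n))
    (t : EuclideanSpace ℝ (Fin n)) : ‖rowOperator x t‖ ^ 2 = ∑ i, inner ℝ (x i) t ^ 2 := by
  rw [EuclideanSpace.norm_sq_eq]
  refine Finset.sum_congr rfl fun i _ => ?_
  simp [rowOperator, Finset.sum_apply, Pi.single_apply]

/-- The second-order Taylor remainder is at most `(l W)² exp |l W|`. One factor `exp (W / (2 β))`
absorbs `W²`, the other dominates `exp |l W|`. -/
theorem exp_mul_le_quadratic {W β l : ℝ} (hW : 0 ≤ W) (hβ : 0 < β) (hl : |l| ≤ 1 / (2 * β)) :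
    Real.exp (l * W) ≤ 1 + l * W + 8 * l ^ 2 * β ^ 2 * Real.exp (W / β) := by
  have h1 : Real.exp (l * W) - (1 + l * W) ≤ (l * W) ^ 2 * Real.exp |l * W| := by
    have := Complex.norm_exp_sub_sum_le_norm_mul_exp ((l * W : ℝ) : ℂ) 2
    simp only [Finset.sum_range_succ, Finset.sum_range_zero, Nat.factorial, zero_add] at this
    norm_num at this
    rw [← Complex.ofReal_mul, ← Complex.ofReal_exp, ← Complex.ofReal_one, ← Complex.ofReal_add,
      ← Complex.ofReal_sub, Complex.norm_real] at this
    rw [← sq_abs (l * W), abs_mul]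
    exact (le_abs_self _).trans this
  have h2 : |l * W| ≤ W / β / 2 := by
    rw [abs_mul, abs_of_nonneg hW]
    calc |l| * W ≤ 1 / (2 * β) * W := by gcongr
      _ = W / β / 2 := by field_simp
  have h3 : (W / β / 2) ^ 2 / 2 ≤ Real.exp (W / β / 2) := by
    simpa using Real.pow_div_factorial_le_exp (W / β / 2) (by positivity) 2
  have h4 : W ^ 2 ≤ 8 * β ^ 2 * Real.exp (W / β / 2) := by
    have : W ^ 2 = 8 * β ^ 2 * ((W / β / 2) ^ 2 / 2) := by field_simp; norm_num
    rw [this]; gcongr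
  have h5 : (l * W) ^ 2 * Real.exp |l * W| ≤ 8 * l ^ 2 * β ^ 2 * Real.exp (W / β) := by
    calc (l * W) ^ 2 * Real.exp |l * W|
        ≤ l ^ 2 * (8 * β ^ 2 * Real.exp (W / β / 2)) * Real.exp (W / β / 2) := by
          rw [mul_pow]; gcongr
      _ = 8 * l ^ 2 * β ^ 2 * (Real.exp (W / β / 2) * Real.exp (W / β / 2)) := by ring
      _ = _ := by rw [← Real.exp_add, add_halves]
  linarith

/-- Bernstein's moment generating function bound for a nonnegative sub-exponential variable. -/
theorem mgf_le_of_integral_exp_le_two {Ω : Type*} [MeasurableSpace Ω] {ν : Measure Ω}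
    [IsProbabilityMeasure ν] {W : Ω → ℝ} (hW0 : ∀ ω, 0 ≤ W ω) (hint : Integrable W ν)
    (hmean : ∫ ω, W ω ∂ν = 1) {β l : ℝ} (hβ : 0 < β)
    (hexp : Integrable (fun ω => Real.exp (W ω / β)) ν) (hexp2 : ∫ ω, Real.exp (W ω / β) ∂ν ≤ 2)
    (hl : |l| ≤ 1 / (2 * β)) :
    Integrable (fun ω => Real.exp (l * W ω)) ν ∧
      mgf W ν l ≤ Real.exp (l + 16 * l ^ 2 * β ^ 2) := by
  have hdom : Integrable (fun ω => 1 + l * W ω + 8 * l ^ 2 * β ^ 2 * Real.exp (W ω / β)) ν :=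
    ((integrable_const 1).add (hint.const_mul l)).add (hexp.const_mul _)
  have hI : Integrable (fun ω => Real.exp (l * W ω)) ν := by
    refine hdom.mono' ?_ (Filter.Eventually.of_forall fun ω => ?_)
    · exact Real.continuous_exp.comp_aestronglyMeasurable (hint.1.const_mul l)
    · rw [Real.norm_of_nonneg (Real.exp_nonneg _)]
      exact exp_mul_le_quadratic (hW0 ω) hβ hl
  refine ⟨hI, ?_⟩
  calc mgf W ν l ≤ ∫ ω, (1 + l * W ω + 8 * l ^ 2 * β ^ 2 * Real.exp (W ω / β)) ∂ν :=
        integral_mono hI hdom fun ω => exp_mul_le_quadratic (hW0 ω) hβ hl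
    _ = 1 + l + 8 * l ^ 2 * β ^ 2 * ∫ ω, Real.exp (W ω / β) ∂ν := by
        rw [integral_add (f := fun ω => 1 + l * W ω)
          ((integrable_const 1).add (hint.const_mul l)) (hexp.const_mul _),
          integral_add (integrable_const 1) (hint.const_mul l), integral_const_mul,
          integral_const_mul, hmean]
        simp
    _ ≤ 1 + l + 8 * l ^ 2 * β ^ 2 * 2 := by gcongr
    _ = (l + 16 * l ^ 2 * β ^ 2) + 1 := by ring
    _ ≤ _ := Real.add_one_le_exp _

/-- The mean and the exponential moment of `⟨X, y⟩²` for a unit vector `y`. -/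
theorem moments_inner_sq {n : ℕ} {μ : Measure (EuclideanSpace ℝ (Fin n))} {α : ℝ} (hα : 1 ≤ α)
    (hiso : IsIsotropic μ) (hpsi : IsPsi2With μ α) {y : EuclideanSpace ℝ (Fin n)} (hy : ‖y‖ = 1) :
    Integrable (fun x => inner ℝ x y ^ 2) μ ∧ ∫ x, inner ℝ x y ^ 2 ∂μ = 1 ∧
      Integrable (fun x => Real.exp (inner ℝ x y ^ 2 / (4 * α ^ 2))) μ ∧
      ∫ x, Real.exp (inner ℝ x y ^ 2 / (4 * α ^ 2)) ∂μ ≤ 2 := by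
  have hcont : Continuous fun x : EuclideanSpace ℝ (Fin n) => inner ℝ x y ^ 2 := by fun_prop
  have hcexp : Continuous fun x : EuclideanSpace ℝ (Fin n) =>
      Real.exp (inner ℝ x y ^ 2 / (4 * α ^ 2)) := by fun_prop
  have h1 := hiso y
  rw [hy, one_pow, ENNReal.ofReal_one] at h1
  -- Relaxing `α` to `2 α` makes the inequality strict and yields an admissible `u` without
  -- attainment of the infimum; hence `4 α²`.
  have hlt : psi2Norm μ (fun x => inner ℝ x y) < ENNReal.ofReal (2 * α) := by
    refine (hpsi y).trans_lt ?_
    rw [hy, mul_one]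
    exact (ENNReal.ofReal_lt_ofReal_iff (by linarith)).2 (by linarith)
  simp only [psi2Norm, iInf_lt_iff] at hlt
  obtain ⟨u, hu, hle, hlt⟩ := hlt
  have hu2 : u < 2 * α := (ENNReal.ofReal_lt_ofReal_iff (by linarith)).1 hlt
  have h2 : ∫⁻ x, ENNReal.ofReal (Real.exp (inner ℝ x y ^ 2 / (4 * α ^ 2))) ∂μ ≤ 2 := by
    refine le_trans (lintegral_mono fun x => ?_) hle
    refine ENNReal.ofReal_le_ofReal (Real.exp_le_exp.2 ?_)
    have : u ^ 2 ≤ 4 * α ^ 2 := by nlinarith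
    gcongr
  refine ⟨⟨hcont.aestronglyMeasurable, ?_⟩, ?_, ⟨hcexp.aestronglyMeasurable, ?_⟩, ?_⟩
  · rw [hasFiniteIntegral_iff_ofReal (Filter.Eventually.of_forall fun _ => sq_nonneg _), h1]
    exact ENNReal.one_lt_top
  · rw [integral_eq_lintegral_of_nonneg_ae (Filter.Eventually.of_forall fun _ => sq_nonneg _)
      hcont.aestronglyMeasurable, h1, ENNReal.toReal_one]
  · rw [hasFiniteIntegral_iff_ofReal (Filter.Eventually.of_forall fun _ => Real.exp_nonneg _)]
    exact h2.trans_lt (by simp)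
  · rw [integral_eq_lintegral_of_nonneg_ae
      (Filter.Eventually.of_forall fun _ => Real.exp_nonneg _) hcexp.aestronglyMeasurable]
    exact ENNReal.toReal_le_of_le_ofReal (by norm_num) (by simpa using h2)

section Concentration

variable {Ω : Type*} [MeasurableSpace Ω] {P : Measure Ω} {k n : ℕ}
  {μ : Measure (EuclideanSpace ℝ (Fin n))} [IsProbabilityMeasure μ] {α : ℝ}
  {X : Fin k → Ω → EuclideanSpace ℝ (Fin n)}

theorem mgf_sum_inner_sq_le (hα : 1 ≤ α) (hiso : IsIsotropic μ) (hpsi : IsPsi2With μ α)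
    (hind : iIndepFun X P) (hlaw : ∀ i, HasLaw (X i) μ P) {y : EuclideanSpace ℝ (Fin n)}
    (hy : ‖y‖ = 1) {l : ℝ} (hl : |l| ≤ 1 / (2 * (4 * α ^ 2))) :
    Integrable (fun ω => Real.exp (l * ∑ i, inner ℝ (X i ω) y ^ 2)) P ∧
      mgf (fun ω => ∑ i, inner ℝ (X i ω) y ^ 2) P l ≤
        Real.exp (k * (l + 16 * l ^ 2 * (4 * α ^ 2) ^ 2)) := by
  obtain ⟨h1, h2, h3, h4⟩ := moments_inner_sq hα hiso hpsi hy
  obtain ⟨hI, hm⟩ := mgf_le_of_integral_exp_le_two (fun x => sq_nonneg (inner ℝ x y)) h1 h2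
    (by positivity) h3 h4 hl
  have hcont : Continuous fun x : EuclideanSpace ℝ (Fin n) => inner ℝ x y ^ 2 := by fun_prop
  have hmgf := (hind.comp (fun _ x => inner ℝ x y ^ 2) fun _ => hcont.measurable).mgf_sum₀ (t := l)
    (fun i => hcont.measurable.comp_aemeasurable (hlaw i).aemeasurable) Finset.univ
  have hone : ∀ i, mgf ((fun x => inner ℝ x y ^ 2) ∘ X i) P l =
      mgf (fun x => inner ℝ x y ^ 2) μ l := fun i => by
    rw [← (hlaw i).map_eq, mgf_map (hlaw i).aemeasurable]
    exact (Continuous.aestronglyMeasurable (by fun_prop))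
  have hfun : (∑ i, (fun x => inner ℝ x y ^ 2) ∘ X i) =
      fun ω => ∑ i, inner ℝ (X i ω) y ^ 2 := by
    ext ω; simp
  rw [hfun] at hmgf
  simp only [hone, Finset.prod_const, Finset.card_univ, Fintype.card_fin] at hmgf
  refine ⟨?_, ?_⟩
  -- A non-integrable function has integral `0` by convention, so positivity of the moment
  -- generating function suffices.
  · refine Integrable.of_integral_ne_zero ?_
    change mgf (fun ω => ∑ i, inner ℝ (X i ω) y ^ 2) P l ≠ 0
    rw [hmgf]
    exact (pow_pos (mgf_pos hI) k).ne'
  · rw [hmgf, Real.exp_nat_mul]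
    exact pow_le_pow_left₀ mgf_nonneg hm k

variable [IsProbabilityMeasure P]

theorem measureReal_norm_rowOperator_unit (hα : 1 ≤ α) (hiso : IsIsotropic μ)
    (hpsi : IsPsi2With μ α) (hind : iIndepFun X P) (hlaw : ∀ i, HasLaw (X i) μ P)
    {y : EuclideanSpace ℝ (Fin n)} (hy : ‖y‖ = 1) :
    P.real {ω | ¬ (3 / 4 * (k : ℝ) ≤ ‖rowOperator (fun i => X i ω) y‖ ^ 2 ∧
        ‖rowOperator (fun i => X i ω) y‖ ^ 2 ≤ 5 / 4 * k)} ≤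
      2 * Real.exp (-(k / α ^ 4 / 16384)) := by
  simp only [norm_rowOperator_sq]
  -- With `β = 4 α²`, this minimises the Chernoff exponent `-l/4 + 16 l² β²`; the minimum is `-l/8 =
  -- -1 / (16384 α⁴)`.
  set l : ℝ := 1 / (128 * (4 * α ^ 2) ^ 2) with hl
  have hα0 : 0 < α := by linarith
  have hl0 : 0 ≤ l := by positivity
  have habs : |l| ≤ 1 / (2 * (4 * α ^ 2)) := by
    rw [abs_of_nonneg hl0, hl]
    gcongr 1 / ?_
    nlinarith [one_le_pow₀ hα (n := 2)]
  obtain ⟨hI1, hm1⟩ := mgf_sum_inner_sq_le hα hiso hpsi hind hlaw hy habs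
  obtain ⟨hI2, hm2⟩ := mgf_sum_inner_sq_le hα hiso hpsi hind hlaw hy (l := -l)
    (by rwa [abs_neg])
  have ht1 := measure_ge_le_exp_mul_mgf (5 / 4 * (k : ℝ)) hl0 hI1
  have ht2 := measure_le_le_exp_mul_mgf (3 / 4 * (k : ℝ)) (neg_nonpos.2 hl0) hI2
  have hsub : {ω | ¬ (3 / 4 * (k : ℝ) ≤ ∑ i, inner ℝ (X i ω) y ^ 2 ∧
      ∑ i, inner ℝ (X i ω) y ^ 2 ≤ 5 / 4 * k)} ⊆
      {ω | 5 / 4 * (k : ℝ) ≤ ∑ i, inner ℝ (X i ω) y ^ 2} ∪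
        {ω | ∑ i, inner ℝ (X i ω) y ^ 2 ≤ 3 / 4 * k} := by
    intro ω hω
    by_contra hcon
    simp only [Set.mem_union, Set.mem_ofPred_eq, not_or, not_le] at hcon
    exact hω ⟨hcon.2.le, hcon.1.le⟩
  have e1 : Real.exp (-l * (5 / 4 * k)) * Real.exp (k * (l + 16 * l ^ 2 * (4 * α ^ 2) ^ 2)) =
      Real.exp (-(k / α ^ 4 / 16384)) := by
    rw [← Real.exp_add, hl]
    congr 1
    field_simp
    ring
  have e2 : Real.exp (-(-l) * (3 / 4 * k)) *
      Real.exp (k * (-l + 16 * (-l) ^ 2 * (4 * α ^ 2) ^ 2)) =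
      Real.exp (-(k / α ^ 4 / 16384)) := by
    rw [← Real.exp_add, hl]
    congr 1
    field_simp
    ring
  calc _ ≤ _ := measureReal_mono hsub
    _ ≤ _ := measureReal_union_le _ _
    _ ≤ Real.exp (-(k / α ^ 4 / 16384)) + Real.exp (-(k / α ^ 4 / 16384)) := by
      gcongr
      · rw [← e1]; exact ht1.trans (by gcongr)
      · rw [← e2]; exact ht2.trans (by gcongr)
    _ = _ := by ring

/-- `‖Γ y‖² / k` concentrates around `‖y‖²`. -/
theorem measureReal_norm_rowOperator (hα : 1 ≤ α) (hiso : IsIsotropic μ) (hpsi : IsPsi2With μ α)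
    (hind : iIndepFun X P) (hlaw : ∀ i, HasLaw (X i) μ P) (y : EuclideanSpace ℝ (Fin n)) :
    P.real {ω | ¬ (3 / 4 * (k : ℝ) * ‖y‖ ^ 2 ≤ ‖rowOperator (fun i => X i ω) y‖ ^ 2 ∧
        ‖rowOperator (fun i => X i ω) y‖ ^ 2 ≤ 5 / 4 * k * ‖y‖ ^ 2)} ≤
      2 * Real.exp (-(k / α ^ 4 / 16384)) := by
  rcases eq_or_ne y 0 with rfl | hy
  · simp
    positivity
  have hpos := norm_pos_iff.2 hy
  have hunit : ‖(‖y‖⁻¹ : ℝ) • y‖ = 1 := by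
    rw [norm_smul, norm_inv, norm_norm, inv_mul_cancel₀ hpos.ne']
  convert measureReal_norm_rowOperator_unit hα hiso hpsi hind hlaw hunit using 6 with ω
  · rw [map_smul, norm_smul, norm_inv, norm_norm, mul_pow, inv_pow, ← div_eq_inv_mul,
      le_div_iff₀ (by positivity)]
  · rw [map_smul, norm_smul, norm_inv, norm_norm, mul_pow, inv_pow, ← div_eq_inv_mul,
      div_le_iff₀ (by positivity)]

/-- The restricted isomorphism property of `Γ` on `m`-sparse vectors, by a union bound. -/
theorem measureReal_sparse_bounds (hα : 1 ≤ α) (hiso : IsIsotropic μ) (hpsi : IsPsi2With μ α)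
    (hind : iIndepFun X P) (hlaw : ∀ i, HasLaw (X i) μ P) {m : ℕ} (hmn : m ≤ n) :
    P.real {ω | ¬ ∀ v : EuclideanSpace ℝ (Fin n), suppCard v ≤ m →
        (k : ℝ) / 64 * ‖v‖ ^ 2 ≤ ‖rowOperator (fun i => X i ω) v‖ ^ 2 ∧
        ‖rowOperator (fun i => X i ω) v‖ ^ 2 ≤ 4 * k * ‖v‖ ^ 2} ≤
      n.choose m * 25 ^ m * (2 * Real.exp (-(k / α ^ 4 / 16384))) := by
  classical
  choose N hN htest using fun T : Finset (Fin n) => exists_test_vectors T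
  let bad : EuclideanSpace ℝ (Fin n) → Set Ω := fun y =>
    {ω | ¬ (3 / 4 * (k : ℝ) * ‖y‖ ^ 2 ≤ ‖rowOperator (fun i => X i ω) y‖ ^ 2 ∧
        ‖rowOperator (fun i => X i ω) y‖ ^ 2 ≤ 5 / 4 * k * ‖y‖ ^ 2)}
  let F : Finset (Finset (Fin n)) := Finset.univ.powersetCard m
  have hsub : {ω | ¬ ∀ v : EuclideanSpace ℝ (Fin n), suppCard v ≤ m →
        (k : ℝ) / 64 * ‖v‖ ^ 2 ≤ ‖rowOperator (fun i => X i ω) v‖ ^ 2 ∧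
        ‖rowOperator (fun i => X i ω) v‖ ^ 2 ≤ 4 * k * ‖v‖ ^ 2} ⊆
      ⋃ T ∈ F, ⋃ y ∈ N T, bad y := by
    intro ω hω
    by_contra hcon
    simp only [Set.mem_iUnion, not_exists] at hcon
    refine hω fun v hv => ?_
    -- Supports are enlarged to exactly `m` elements, so only `n.choose m` sets enter the union
    -- bound.
    obtain ⟨T, hT, hcard⟩ := Finset.exists_superset_card_eq hv (by simpa using hmn)
    refine htest T _ k k.cast_nonneg (fun y hy => ?_) v fun i hi => ?_
    · have := hcon T (Finset.mem_powersetCard.2 ⟨Finset.subset_univ _, hcard⟩) y hy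
      simpa only [bad, Set.mem_ofPred_eq, not_not] using this
    · by_contra hvi
      exact hi (hT (by simpa using hvi))
  calc _ ≤ P.real (⋃ T ∈ F, ⋃ y ∈ N T, bad y) := measureReal_mono hsub (measure_ne_top _ _)
    _ ≤ ∑ T ∈ F, P.real (⋃ y ∈ N T, bad y) := measureReal_biUnion_finset_le _ _
    _ ≤ ∑ T ∈ F, 25 ^ m * (2 * Real.exp (-(k / α ^ 4 / 16384))) := by
      refine Finset.sum_le_sum fun T hT => ?_
      refine (measureReal_biUnion_finset_le _ _).trans ?_
      refine (Finset.sum_le_card_nsmul _ _ _ fun y _ =>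
        measureReal_norm_rowOperator hα hiso hpsi hind hlaw y).trans ?_
      rw [nsmul_eq_mul]
      have h1 := hN T
      rw [(Finset.mem_powersetCard.1 hT).2] at h1
      have h2 : ((N T).card : ℝ) ≤ 25 ^ m := by exact_mod_cast h1
      gcongr
    _ = _ := by
      simp [F, Finset.card_powersetCard, mul_assoc]

end Concentration

/-! ### Entropy count, constants and conclusion -/

/-- With `M = q / log R`, the left side is at most `(50 n / M)^m · M^m / m!`. Here `50 n / M = R log
R ≤ R²` contributes `2 q` to the exponent, and `M^m / m! ≤ exp M` contributes at most `q`. The `50`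
is the net base `25` times `2` for the two tails. -/
theorem choose_mul_pow_le_exp {n m : ℕ} {q R : ℝ} (hq : 0 < q) (hR : 1 ≤ Real.log R) (hR0 : 0 < R)
    (hRn : R = 50 * n / q) (hm : (m : ℝ) ≤ q / Real.log R) :
    (n.choose m : ℝ) * 50 ^ m ≤ Real.exp (3 * q) := by
  set L := Real.log R with hL
  have hL0 : 0 < L := by linarith
  set M := q / L with hM
  have hM0 : 0 < M := by positivity
  have h1 : 50 * (n : ℝ) / M ≤ Real.exp (2 * L) := by
    have e1 : 50 * (n : ℝ) / M = R * L := by rw [hM, hRn]; field_simp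
    have e2 : Real.exp (2 * L) = R * R := by
      rw [two_mul, Real.exp_add, hL, Real.exp_log hR0]
    rw [e1, e2]
    have := Real.log_le_self hR0.le
    gcongr
  have hMq : M ≤ q := div_le_self hq.le hR
  have hmL : (m : ℝ) * L ≤ q := by rwa [le_div_iff₀ hL0] at hm
  calc (n.choose m : ℝ) * 50 ^ m ≤ (n : ℝ) ^ m / m.factorial * 50 ^ m := by
        gcongr; exact Nat.choose_le_pow_div m n
    _ = (50 * n / M) ^ m * (M ^ m / m.factorial) := by
        rw [div_pow, mul_pow]; field_simp
    _ ≤ Real.exp (2 * L) ^ m * Real.exp M := by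
        gcongr
        exact Real.pow_div_factorial_le_exp M hM0.le m
    _ = Real.exp (2 * (m * L) + M) := by
        rw [← Real.exp_nat_mul, ← Real.exp_add]; ring_nf
    _ ≤ _ := Real.exp_le_exp.2 (by linarith)

theorem isUniqueMinimizerOn_l1Norm_zero {n : ℕ} {z : EuclideanSpace ℝ (Fin n)} (hz : suppCard z = 0)
    {s : Set (EuclideanSpace ℝ (Fin n))} (hs : z ∈ s) : IsUniqueMinimizerOn l1Norm s z := by
  have hz0 : ∀ i, z i = 0 := by simpa [suppCard, Finset.filter_eq_empty_iff] using hz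
  refine ⟨hs, fun t _ htz => ?_⟩
  obtain ⟨i, hi⟩ : ∃ i, t i ≠ 0 := by
    by_contra! h
    exact htz (by ext i; rw [h i, hz0 i])
  have : l1Norm z = 0 := by simp [l1Norm, hz0]
  rw [this]
  exact Finset.sum_pos' (fun _ _ => abs_nonneg _) ⟨i, Finset.mem_univ i, abs_pos.2 hi⟩

/-- The restricted isomorphism property implies reconstruction of `s`-sparse vectors. -/
theorem isUniqueMinimizerOn_of_sparse_bounds {n k s : ℕ} (hk : 1 ≤ k) (hs : 1 ≤ s)
    (A : EuclideanSpace ℝ (Fin n) →L[ℝ] EuclideanSpace ℝ (Fin k))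
    (h : ∀ v : EuclideanSpace ℝ (Fin n), suppCard v ≤ 1026 * s →
      (k : ℝ) / 64 * ‖v‖ ^ 2 ≤ ‖A v‖ ^ 2 ∧ ‖A v‖ ^ 2 ≤ 4 * k * ‖v‖ ^ 2)
    {z : EuclideanSpace ℝ (Fin n)} (hz : suppCard z ≤ s) :
    IsUniqueMinimizerOn l1Norm {t | A t = A z} z := by
  classical
  have hk' : (1 : ℝ) ≤ k := by exact_mod_cast hk
  have hs' : (1 : ℝ) ≤ s := by exact_mod_cast hs
  refine isUniqueMinimizerOn_l1Norm A (a := k / 64) (b := 4 * k) (m := 1026 * s) (by omega)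
    (by positivity) (by positivity) ?_ (fun v hv => (h v hv).1) (fun j => ?_) hz
  -- The requirement is `1024 s < 1026 s - 1`; with `1025` it would fail at `s = 1`.
  · push_cast
    nlinarith
  · have hcard : suppCard (EuclideanSpace.single j (1 : ℝ)) ≤ 1026 * s := by
      have : (Finset.univ.filter fun i => EuclideanSpace.single j (1 : ℝ) i ≠ 0) ⊆ {j} := by
        intro i hi
        by_contra hij
        simp only [Finset.mem_singleton] at hij
        simp [hij] at hi
      exact (Finset.card_le_card this).trans (by simp; omega)
    simpa using (h _ hcard).2

theorem mainTheorem5 :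
    ∃ c C cbar : ℝ, 1 < c ∧ 0 < C ∧ 0 < cbar ∧
      ∀ (k n : ℕ), 1 ≤ k → k ≤ n →
      ∀ (α : ℝ), 1 ≤ α →
      ∀ (μ : Measure (EuclideanSpace ℝ (Fin n))) [IsProbabilityMeasure μ],
        IsIsotropic μ → IsPsi2With μ α →
      ∀ (Ω : Type*) [MeasurableSpace Ω] (P : Measure Ω) [IsProbabilityMeasure P]
        (X : Fin k → Ω → EuclideanSpace ℝ (Fin n)),
        iIndepFun X P → (∀ i, HasLaw (X i) μ P) →
        1 - Real.exp (-(cbar * k / α ^ 4)) ≤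
          P.real {ω | ∀ z : EuclideanSpace ℝ (Fin n),
            (suppCard z : ℝ) ≤ C * k / (α ^ 4 * Real.log (c * n * α ^ 4 / k)) →
            IsUniqueMinimizerOn l1Norm
              {t | rowOperator (fun i => X i ω) t = rowOperator (fun i => X i ω) z} z} := by
  -- `98304 = 6 · 16384` makes the entropy `3 q` half of the concentration exponent, leaving `1 /
  -- 32768`; `4915200 = 50 · 98304` gives `R = 50 n / q`.
  refine ⟨4915200, 1 / (1026 * 98304), 1 / 32768, by norm_num, by norm_num, by norm_num, ?_⟩
  intro k n hk hkn α hα μ _ hiso hpsi Ω _ P _ X hind hlaw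
  have hk' : (1 : ℝ) ≤ k := by exact_mod_cast hk
  have hkn' : (k : ℝ) ≤ n := by exact_mod_cast hkn
  have hα4 : 1 ≤ α ^ 4 := one_le_pow₀ hα
  set R : ℝ := 4915200 * n * α ^ 4 / k with hR
  have hRge : 4915200 ≤ R := by
    rw [hR, le_div_iff₀ (by positivity)]
    nlinarith
  have hlog : 1 ≤ Real.log R := by
    rw [Real.le_log_iff_exp_le (by linarith)]
    linarith [Real.exp_one_lt_three]
  set σ : ℝ := 1 / (1026 * 98304) * k / (α ^ 4 * Real.log R) with hσ
  have hσ0 : 0 ≤ σ := by positivity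
  set s := ⌊σ⌋₊ with hs
  -- For `s = 0` only `z = 0` is admissible and recovery is certain; otherwise `m ≥ 1`, so `2 ^ m`
  -- absorbs the factor `2`.
  rcases Nat.eq_zero_or_pos s with hs0 | hs1
  · have huniv : {ω | ∀ z : EuclideanSpace ℝ (Fin n), (suppCard z : ℝ) ≤ σ →
        IsUniqueMinimizerOn l1Norm
          {t | rowOperator (fun i => X i ω) t = rowOperator (fun i => X i ω) z} z} = Set.univ := by
      refine Set.eq_univ_of_forall fun ω z hz => isUniqueMinimizerOn_l1Norm_zero ?_ rfl
      have := Nat.le_floor hz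
      omega
    rw [huniv, probReal_univ]
    linarith [Real.exp_nonneg (-(1 / 32768 * (k : ℝ) / α ^ 4))]
  set m := 1026 * s with hm
  set q : ℝ := k / α ^ 4 / 98304 with hq
  have hq0 : 0 < q := by positivity
  have hmM : (m : ℝ) ≤ q / Real.log R := by
    have h1 : (s : ℝ) ≤ σ := Nat.floor_le hσ0
    calc (m : ℝ) = 1026 * s := by rw [hm]; push_cast; ring
      _ ≤ 1026 * σ := by gcongr
      _ = q / Real.log R := by rw [hσ, hq]; field_simp
  have hmn : m ≤ n := by
    have h1 : q / Real.log R ≤ q := div_le_self hq0.le hlog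
    have h2 : q ≤ k := by
      rw [hq, div_div]
      exact div_le_self (by positivity) (by nlinarith)
    exact_mod_cast hmM.trans (h1.trans (h2.trans hkn'))
  have hprob := measureReal_sparse_bounds hα hiso hpsi hind hlaw hmn
  have hcount := choose_mul_pow_le_exp hq0 hlog (by linarith) (n := n)
    (by rw [hR, hq]; field_simp; ring) hmM
  have hbad : (n.choose m : ℝ) * 25 ^ m * (2 * Real.exp (-(k / α ^ 4 / 16384))) ≤
      Real.exp (-(1 / 32768 * k / α ^ 4)) := by
    have h2 : (2 : ℝ) ≤ 2 ^ m := le_self_pow₀ (by norm_num) (by omega)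
    calc (n.choose m : ℝ) * 25 ^ m * (2 * Real.exp (-(k / α ^ 4 / 16384)))
        ≤ n.choose m * 25 ^ m * (2 ^ m * Real.exp (-(k / α ^ 4 / 16384))) := by gcongr
      _ = n.choose m * 50 ^ m * Real.exp (-(k / α ^ 4 / 16384)) := by
        rw [show (50 : ℝ) = 25 * 2 by norm_num, mul_pow]; ring
      _ ≤ Real.exp (3 * q) * Real.exp (-(k / α ^ 4 / 16384)) := by gcongr
      _ = _ := by rw [← Real.exp_add, hq]; congr 1; ring
  -- Covering the whole space and using subadditivity avoids proving the recovery event measurable.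
  have hcover : Set.univ ⊆ {ω | ∀ z : EuclideanSpace ℝ (Fin n), (suppCard z : ℝ) ≤ σ →
        IsUniqueMinimizerOn l1Norm
          {t | rowOperator (fun i => X i ω) t = rowOperator (fun i => X i ω) z} z} ∪
      {ω | ¬ ∀ v : EuclideanSpace ℝ (Fin n), suppCard v ≤ m →
        (k : ℝ) / 64 * ‖v‖ ^ 2 ≤ ‖rowOperator (fun i => X i ω) v‖ ^ 2 ∧
        ‖rowOperator (fun i => X i ω) v‖ ^ 2 ≤ 4 * k * ‖v‖ ^ 2} := by
    intro ω _
    rw [Set.mem_union, or_iff_not_imp_right]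
    intro hω z hz
    exact isUniqueMinimizerOn_of_sparse_bounds hk hs1 _ (not_not.1 hω) (Nat.le_floor hz)
  have htot := (measureReal_mono hcover).trans (measureReal_union_le (μ := P) _ _)
  rw [probReal_univ] at htot
  linarith
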